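/- Let $r\ge 0$ and $\mathbf m=(m_0,\dots,m_r)\in\mathbb N^{r+1}$, and put $\mathbb N_{\mathbf m}=\{\mathbf i\in\mathbb N^{r+1}: 0\le i_j\le m_j \text{ for all } j\}$. For $m\in\mathbb N$ let $M_m$ be the $(m+1)\times(m+1)$ integer matrix with entries $(M_m)_{s,i}=2^i\binom{m-s}{i}$, $0\le s,i\le m$, where $\binom{a}{i}=0$ for $i>a$. Let $M_{\mathbf m}=M_{m_0}\otimes\cdots\otimes M_{m_r}$ be the Kronecker product, with rows and columns indexed by $\mathbb N_{\mathbf m}$. A vector in $\mathbb Z^{\mathbb N_{\mathbf m}}$ is called a $\beta$-integral multireal vector if it belongs to $M_{\mathbf m}\mathbb Z^{\mathbb N_{\mathbf m}}$. Let $w=(w_{\mathbf s})\in\mathbb Z^{\mathbb N_{\mathbf m}}$. Then $M_{\mathbf m}$ is invertible over $\mathbb Q$, and there is exactly one family of rational numbers $c=(c_{\mathbf i}^{\mathbf u})$, indexed by the pairs $(\mathbf u,\mathbf i)$ with $\mathbf u,\mathbf i,\mathbf u+\mathbf i\in\mathbb N_{\mathbf m}$ (the multi-triangle of $w$), such that $$c_{\mathbf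 0}^{\mathbf u}=w_{\mathbf m-\mathbf u},\qquad c_{\mathbf i}^{\mathbf u}=\tfrac12\bigl(c_{\mathbf i-e_j}^{\mathbf u+e_j}-c_{\mathbf i-e_j}^{\mathbf u}\bigr)\ \text{ for every } j \text{ with } i_j>0,$$ where $e_0,\dots,e_r$ is the canonical basis of $\mathbb Z^{r+1}$. The vector $b=(b_{\mathbf i})\in\mathbb Q^{\mathbb N_{\mathbf m}}$ defined by $b_{\mathbf i}=c_{\mathbf i}^{\mathbf 0}$ is $b=M_{\mathbf m}^{-1}w$. Moreover, the following three properties are equivalent: 1. $w$ is a $\beta$-integral multireal vector; 2. $b$ is an integral vector, i.e. $b\in\mathbb Z^{\mathbb N_{\mathbf m}}$; 3. $c$ is integral, i.e. $c_{\mathbf i}^{\mathbf u}\in\mathbb Z$ for all $\mathbf u,\mathbf i,\mathbf u+\mathbf i\in\mathbb N_{\mathbf m}$. -/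

import Mathlib

open scoped Matrix

namespace Multireal

/-- The index set `ℕ_𝐦 = {𝐢 : 0 ≤ i_j ≤ m_j for all j}`, for `𝐦 = (m_0, …, m_r)`. -/
abbrev MultiIndex {r : ℕ} (m : Fin (r + 1) → ℕ) : Type :=
  (j : Fin (r + 1)) → Fin (m j + 1)

/-- The `(m+1) × (m+1)` integer matrix with entries `(M_m)_{s,i} = 2^i * binom (m - s) i`,
`0 ≤ s, i ≤ m` (so `m - s` is never truncated). -/
def M (m : ℕ) : Matrix (Fin (m + 1)) (Fin (m + 1)) ℤ :=
  Matrix.of fun s i => 2 ^ (i : ℕ) * (Nat.choose (m - (s : ℕ)) (i : ℕ) : ℤ)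

/-- The Kronecker product of a finite family of matrices, indexed by tuples. -/
def kroneckerFamily {J R : Type*} [Fintype J] [CommSemiring R] {ι κ : J → Type*}
    (A : (j : J) → Matrix (ι j) (κ j) R) : Matrix ((j : J) → ι j) ((j : J) → κ j) R :=
  Matrix.of fun s i => ∏ j, A j (s j) (i j)

/-- The matrix `M_𝐦 = M_{m_0} ⊗ ⋯ ⊗ M_{m_r}`, indexed by `ℕ_𝐦`. -/
def multiM {r : ℕ} (m : Fin (r + 1) → ℕ) : Matrix (MultiIndex m) (MultiIndex m) ℤ :=
  kroneckerFamily fun j => M (m j)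

/-- `M_𝐦` regarded as a matrix over `ℚ`. -/
def multiMRat {r : ℕ} (m : Fin (r + 1) → ℕ) : Matrix (MultiIndex m) (MultiIndex m) ℚ :=
  (multiM m).map (Int.cast : ℤ → ℚ)

/-- The set `M_𝐦 ℤ^{ℕ_𝐦} ⊆ ℤ^{ℕ_𝐦}` of `β`-integral multireal vectors. -/
def betaIntegralMultirealVectors {r : ℕ} (m : Fin (r + 1) → ℕ) : Set (MultiIndex m → ℤ) :=
  Set.range fun b : MultiIndex m → ℤ => multiM m *ᵥ b

/-- The canonical basis vector `e_j`. -/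
def e {r : ℕ} (j : Fin (r + 1)) : Fin (r + 1) → ℕ := Pi.single j 1

/-- A family of rational numbers `c_𝐢^𝐮`, written `c u i h`, indexed by the pairs `𝐮, 𝐢 ∈ ℕ^{r+1}`
with `𝐮 + 𝐢 ∈ ℕ_𝐦`, that is `𝐮 + 𝐢 ≤ 𝐦` (hence also `𝐮, 𝐢 ∈ ℕ_𝐦`). -/
abbrev TriangleFamily {r : ℕ} (m : Fin (r + 1) → ℕ) : Type :=
  (u i : Fin (r + 1) → ℕ) → u + i ≤ m → ℚ

/-- The multi-index `𝐦 - 𝐮 ∈ ℕ_𝐦` (used for `𝐮 ∈ ℕ_𝐦`). -/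
def coIndex {r : ℕ} (m u : Fin (r + 1) → ℕ) : MultiIndex m :=
  fun j => ⟨m j - u j, Nat.lt_succ_of_le (Nat.sub_le _ _)⟩

theorem le_of_add_add_e {r : ℕ} {m u i : Fin (r + 1) → ℕ} {j : Fin (r + 1)}
    (h : u + (i + e j) ≤ m) : u + i ≤ m := fun k => by
  have := h k
  simp only [Pi.add_apply] at this ⊢
  omega

theorem add_e_add_le {r : ℕ} {m u i : Fin (r + 1) → ℕ} {j : Fin (r + 1)}
    (h : u + (i + e j) ≤ m) : (u + e j) + i ≤ m := fun k => by
  have := h k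
  simp only [Pi.add_apply] at this ⊢
  omega

theorem zero_add_val_le {r : ℕ} {m : Fin (r + 1) → ℕ} (i : MultiIndex m) :
    (0 : Fin (r + 1) → ℕ) + (fun j => (i j : ℕ)) ≤ m := fun k => by
  have := (i k).isLt
  simp only [Pi.add_apply, Pi.zero_apply]
  omega

/-- `c` satisfies the initial condition and all instances of the halving recursion for `w`. The
recursion is written with `𝐢 + e_j` in place of `𝐢`, which runs through exactly the
multi-indices whose `j`-th entry is positive. -/
structure IsMultiTriangle {r : ℕ} {m : Fin (r + 1) → ℕ} (w : MultiIndex m → ℤ)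
    (c : TriangleFamily m) : Prop where
  init : ∀ (u : Fin (r + 1) → ℕ) (h : u + 0 ≤ m), c u 0 h = (w (coIndex m u) : ℚ)
  step : ∀ (u i : Fin (r + 1) → ℕ) (j : Fin (r + 1)) (h : u + (i + e j) ≤ m),
    c u (i + e j) h =
      (1 / 2 : ℚ) * (c (u + e j) i (add_e_add_le h) - c u i (le_of_add_add_e h))

/-- The terminal vector `b_𝐢 = c_𝐢^𝟎`. -/
def terminal {r : ℕ} {m : Fin (r + 1) → ℕ} (c : TriangleFamily m) : MultiIndex m → ℚ :=
  fun i => c 0 (fun j => (i j : ℕ)) (zero_add_val_le i)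

/-- A rational vector is integral if all its entries are integers. -/
def IsIntegralVector {I : Type*} (b : I → ℚ) : Prop :=
  ∀ i, ∃ z : ℤ, b i = (z : ℚ)

/-- A multi-triangle is integral if all its entries are integers. -/
def IsIntegralTriangle {r : ℕ} {m : Fin (r + 1) → ℕ} (c : TriangleFamily m) : Prop :=
  ∀ (u i : Fin (r + 1) → ℕ) (h : u + i ≤ m), ∃ z : ℤ, c u i h = (z : ℚ)

end Multireal

namespace Multireal

open MvPolynomial

/-! Let `Ψ` be the linear functional on polynomials with `Ψ(X^u) = w_{m-u}`, and put `Y_j = (X_j -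
1)/2`. Then `c_i^u = Ψ(X^u Y^i)` solves the recursion, and expanding `X^{m-s} = (2Y + 1)^{m-s}` in
powers of `Y` gives `M_m b = w` (`exists_recursion`). As `w` may be any rational vector, `M_m` is
surjective, hence invertible. Uniqueness transfers `M_m b = w` to every multi-triangle; reading the
recursion backwards carries integrality from `b` to all of `c`. -/

/-- A function on exponents extends to a linear functional on polynomials. -/
theorem exists_functional_monomial {σ : Type*} [Fintype σ] (f : (σ → ℕ) → ℚ) :
    ∃ Ψ : MvPolynomial σ ℚ →ₗ[ℚ] ℚ, ∀ u : σ → ℕ, Ψ (∏ j, X j ^ u j) = f u := by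
  refine ⟨(basisMonomials σ ℚ).constr ℚ fun s => f s, fun u => ?_⟩
  have h : (∏ j, X j ^ u j : MvPolynomial σ ℚ) =
      basisMonomials σ ℚ (Finsupp.equivFunOnFinite.symm u) := by
    simp only [coe_basisMonomials]
    rw [monomial_eq, Finsupp.prod_fintype _ _ fun _ => pow_zero _]
    simp
  rw [h, Module.Basis.constr_basis]
  simp

/-- The polynomial `(X_j - 1) / 2`. -/
noncomputable def halfDiff {σ : Type*} (j : σ) : MvPolynomial σ ℚ :=
  C (1 / 2 : ℚ) * (X j - 1)

theorem two_mul_halfDiff_add_one {σ : Type*} (j : σ) :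
    2 * halfDiff j + 1 = (X j : MvPolynomial σ ℚ) := by
  have h : (2 : MvPolynomial σ ℚ) * C (1 / 2 : ℚ) = 1 := by
    rw [show (2 : MvPolynomial σ ℚ) = C 2 from (map_ofNat C 2).symm, ← C_mul]
    norm_num
  rw [halfDiff, ← mul_assoc, h]
  ring

theorem prod_pow_add_e {r : ℕ} {R : Type*} [CommMonoid R] (x : Fin (r + 1) → R)
    (i : Fin (r + 1) → ℕ) (j : Fin (r + 1)) :
    ∏ k, x k ^ (i + e j) k = (∏ k, x k ^ i k) * x j := by
  simp only [Pi.add_apply, pow_add, Finset.prod_mul_distrib]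
  congr 1
  rw [Finset.prod_eq_single j] <;> simp +contextual [e]

theorem add_one_pow_eq_sum_fin {R : Type*} [CommSemiring R] (x : R) {u m : ℕ} (h : u ≤ m) :
    (2 * x + 1) ^ u = ∑ i : Fin (m + 1), (2 ^ (i : ℕ) * (u.choose i : R)) * x ^ (i : ℕ) := by
  rw [Fin.sum_univ_eq_sum_range (fun i => (2 ^ i * (u.choose i : R)) * x ^ i), add_pow]
  rw [← Finset.sum_subset (Finset.range_subset_range.2 (Nat.succ_le_succ h))]
  · exact Finset.sum_congr rfl fun i _ => by rw [mul_pow, one_pow]; ring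
  · intro i _ hi
    rw [Nat.choose_eq_zero_of_lt (by simpa using hi)]
    simp

/-- Row `s` of `M_m` lists the coordinates of `X^{m-s}` in the powers of `Y`, by the binomial
theorem in each variable. -/
theorem prod_X_pow_eq_sum {r : ℕ} (m : Fin (r + 1) → ℕ) (s : MultiIndex m) :
    (∏ j, X j ^ (m j - (s j : ℕ)) : MvPolynomial (Fin (r + 1)) ℚ) =
      ∑ i : MultiIndex m, multiMRat m s i • ∏ j, halfDiff j ^ (i j : ℕ) := by
  simp_rw [← two_mul_halfDiff_add_one]
  rw [Finset.prod_congr rfl fun j _ =>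
    add_one_pow_eq_sum_fin (halfDiff j) (Nat.sub_le (m j) (s j)), Finset.prod_univ_sum,
    Fintype.piFinset_univ]
  refine Finset.sum_congr rfl fun i _ => ?_
  rw [Finset.prod_mul_distrib, smul_eq_C_mul]
  congr 1
  simp [multiMRat, multiM, kroneckerFamily, M, map_prod, map_ofNat]

/-- The halving recursion with rational initial data has a solution whose terminal vector is
a preimage of the data under `M_𝐦`. -/
theorem exists_recursion {r : ℕ} (m : Fin (r + 1) → ℕ) (w : MultiIndex m → ℚ) :
    ∃ c : (Fin (r + 1) → ℕ) → (Fin (r + 1) → ℕ) → ℚ,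
      (∀ u, c u 0 = w (coIndex m u)) ∧
      (∀ u i j, c u (i + e j) = (1 / 2 : ℚ) * (c (u + e j) i - c u i)) ∧
      multiMRat m *ᵥ (fun i => c 0 fun j => (i j : ℕ)) = w := by
  -- Truncated subtraction in `coIndex` supplies values for `u` outside the box, so the recursion
  -- holds without bounds.
  obtain ⟨Ψ, hΨ⟩ := exists_functional_monomial fun u => w (coIndex m u)
  refine ⟨fun u i => Ψ ((∏ j, X j ^ u j) * ∏ j, halfDiff j ^ i j), fun u => ?_,
    fun u i j => ?_, ?_⟩
  · simpa using hΨ u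
  · simp only [prod_pow_add_e]
    rw [← map_sub, ← smul_eq_mul (1 / 2 : ℚ), ← map_smul, smul_eq_C_mul]
    congr 1
    rw [halfDiff]
    ring
  · funext s
    have hs : coIndex m (fun j => m j - (s j : ℕ)) = s := by
      funext j
      ext
      have := (s j).isLt
      simp only [coIndex]
      omega
    have h := hΨ fun j => m j - (s j : ℕ)
    rw [prod_X_pow_eq_sum, map_sum, hs] at h
    simpa [Matrix.mulVec, dotProduct] using h

theorem isUnit_multiMRat {r : ℕ} (m : Fin (r + 1) → ℕ) : IsUnit (multiMRat m) :=
  Matrix.mulVec_surjective_iff_isUnit.1 fun w =>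
    let ⟨_, _, _, h⟩ := exists_recursion m w
    ⟨_, h⟩

theorem exists_isMultiTriangle {r : ℕ} {m : Fin (r + 1) → ℕ} (w : MultiIndex m → ℤ) :
    ∃ c : TriangleFamily m, IsMultiTriangle w c ∧
      multiMRat m *ᵥ terminal c = fun s => (w s : ℚ) := by
  obtain ⟨c, hinit, hstep, hM⟩ := exists_recursion m fun s => (w s : ℚ)
  exact ⟨fun u i _ => c u i, ⟨fun u _ => hinit u, fun u i j _ => hstep u i j⟩, hM⟩

theorem sum_add_e {r : ℕ} (i : Fin (r + 1) → ℕ) (j : Fin (r + 1)) :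
    ∑ k, (i + e j) k = ∑ k, i k + 1 := by
  simp [e, Finset.sum_add_distrib]

/-- Induction on multi-indices, adding one basis vector at a time. -/
theorem induction_add_e {r : ℕ} {P : (Fin (r + 1) → ℕ) → Prop} (zero : P 0)
    (add : ∀ i j, P i → P (i + e j)) (i : Fin (r + 1) → ℕ) : P i := by
  induction h : ∑ k, i k generalizing i with
  | zero =>
    have : i = 0 := by
      funext k
      exact Finset.sum_eq_zero_iff.1 h k (Finset.mem_univ k)
    exact this ▸ zero
  | succ n ih =>
    obtain ⟨j, -, hj⟩ := Finset.exists_ne_zero_of_sum_ne_zero (h.trans_ne n.succ_ne_zero)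
    have hi : i = (i - e j) + e j := by
      funext k
      by_cases hk : k = j
      · subst hk
        simp [e]
        omega
      · simp [e, hk]
    rw [hi]
    refine add _ j (ih _ ?_)
    rw [hi, sum_add_e] at h
    omega

/-- Each step lowers `i` but may raise `u`, so the induction on `i` keeps `u` general. -/
theorem IsMultiTriangle.unique {r : ℕ} {m : Fin (r + 1) → ℕ} {w : MultiIndex m → ℤ}
    {c d : TriangleFamily m} (hc : IsMultiTriangle w c) (hd : IsMultiTriangle w d) : c = d := by
  funext u i
  induction i using induction_add_e generalizing u with
  | zero =>
    funext h
    rw [hc.init, hd.init]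
  | add i j ih =>
    funext h
    rw [hc.step, hd.step, ih, ih]

theorem IsMultiTriangle.mulVec_terminal {r : ℕ} {m : Fin (r + 1) → ℕ} {w : MultiIndex m → ℤ}
    {c : TriangleFamily m} (hc : IsMultiTriangle w c) :
    multiMRat m *ᵥ terminal c = fun s => (w s : ℚ) := by
  obtain ⟨d, hd, h⟩ := exists_isMultiTriangle w
  rwa [hc.unique hd]

theorem IsMultiTriangle.isIntegralTriangle {r : ℕ} {m : Fin (r + 1) → ℕ}
    {w : MultiIndex m → ℤ} {c : TriangleFamily m} (hc : IsMultiTriangle w c)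
    (hb : IsIntegralVector (terminal c)) : IsIntegralTriangle c := by
  intro u
  induction u using induction_add_e with
  | zero =>
    intro i h
    exact hb fun j => ⟨i j, Nat.lt_succ_of_le (by simpa using h j)⟩
  | add u j ih =>
    intro i h
    have h' : u + (i + e j) ≤ m := by
      rwa [add_comm i, ← add_assoc]
    obtain ⟨x, hx⟩ := ih (i + e j) h'
    obtain ⟨y, hy⟩ := ih i (le_of_add_add_e h')
    -- The recursion solved for its raised term: `c_i^{u+e_j} = 2 c_{i+e_j}^u + c_i^u`, with no
    -- division.
    refine ⟨2 * x + y, ?_⟩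
    have := hc.step u i j h'
    rw [hx, hy] at this
    push_cast
    linarith

theorem multiMRat_mulVec_intCast {r : ℕ} (m : Fin (r + 1) → ℕ) (z : MultiIndex m → ℤ) :
    multiMRat m *ᵥ (fun i => (z i : ℚ)) = fun s => ((multiM m *ᵥ z) s : ℚ) := by
  funext s
  simp [multiMRat, Matrix.mulVec, dotProduct]

end Multireal

theorem mainTheorem10 {r : ℕ} (m : Fin (r + 1) → ℕ) (w : Multireal.MultiIndex m → ℤ) :
    IsUnit (Multireal.multiMRat m).det ∧
    (∃! c : Multireal.TriangleFamily m, Multireal.IsMultiTriangle w c) ∧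
    ∀ c : Multireal.TriangleFamily m, Multireal.IsMultiTriangle w c →
      Multireal.terminal c = (Multireal.multiMRat m)⁻¹ *ᵥ (fun s => (w s : ℚ)) ∧
      List.TFAE [
        w ∈ Multireal.betaIntegralMultirealVectors m,
        Multireal.IsIntegralVector (Multireal.terminal c),
        Multireal.IsIntegralTriangle c] := by
  have hunit := Multireal.isUnit_multiMRat m
  have hdet := (Matrix.isUnit_iff_isUnit_det _).1 hunit
  refine ⟨hdet, ?_, fun c hc => ⟨?_, ?_⟩⟩
  · obtain ⟨c, hc, -⟩ := Multireal.exists_isMultiTriangle w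
    exact ⟨c, hc, fun d hd => hd.unique hc⟩
  · rw [← hc.mulVec_terminal, Matrix.mulVec_mulVec, Matrix.nonsing_inv_mul _ hdet,
      Matrix.one_mulVec]
  · tfae_have 1 → 2 := by
      rintro ⟨z, rfl⟩ i
      -- Both vectors have image `w` under the injective `M_m`.
      have h : Multireal.terminal c = fun i => (z i : ℚ) :=
        Matrix.mulVec_injective_of_isUnit hunit
          (hc.mulVec_terminal.trans (Multireal.multiMRat_mulVec_intCast m z).symm)
      exact ⟨z i, congrFun h i⟩
    tfae_have 2 → 3 := hc.isIntegralTriangle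
    tfae_have 3 → 2 := fun h i => h _ _ _
    tfae_have 2 → 1 := by
      intro h
      choose z hz using h
      refine ⟨z, funext fun s => ?_⟩
      have hM := hc.mulVec_terminal
      rw [funext hz, Multireal.multiMRat_mulVec_intCast] at hM
      exact_mod_cast congrFun hM s
    tfae_finish
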